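/- Call a convex function $f:\mathbb{R}^d\to\mathbb{R}$ \emph{$1$-smooth} if it is differentiable and its gradient is $1$-Lipschitz in the Euclidean norm. Let $n\ge 0$, let $h=(h_0,\dots,h_{n-1})$ have positive entries, and let $\eta>0$. For a $1$-smooth convex $f$ and $x_0\in\mathbb{R}^d$, gradient descent with stepsizes $h$ produces $x_{i+1}=x_i-h_i\nabla f(x_i)$ for $0\le i\le n-1$; write $f_i=f(x_i)$ and $g_i=\nabla f(x_i)$ for $0\le i\le n$. Say that $h$ is - \emph{f-composable with rate $\eta$} if $\eta=\frac{1}{1+2\sum_{i=0}^{n-1}h_i}=\prod_{i=0}^{n-1}(h_i-1)^2$ and $f(x_n)-f(x_\star)\le \frac{\eta}{2}\|x_0-x_\star\|^2$, - \emph{g-composable with rate $\eta$} if $\eta=\frac{1}{1+2\sum_{i=0}^{n-1}h_i}=\prod_{i=0}^{n-1}(h_i-1)^2$ and $\frac12\|\nabla f(x_n)\|^2\le \eta\,(f(x_0)-f(x_\star))$, - \emph{s-composable with rate $\eta$} if $\eta=\frac{1}{1+\sum_{i=0}^{n-1}h_i}=\prod_{i=0}^{n-1}(h_i-1)$ and $\frac{1-\eta}{2}\|\nabla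 f(x_n)\|^2+\frac{\eta^2}{2}\|x_n-x_\star\|^2+(\eta-\eta^2)(f(x_n)-f(x_\star))\le\frac{\eta^2}{2}\|x_0-x_\star\|^2$, where each inequality is required for every dimension $d$, every $1$-smooth convex $f:\mathbb{R}^d\to\mathbb{R}$, every minimizer $x_\star$ of $f$ and every $x_0\in\mathbb{R}^d$. Empty sums are $0$ and empty products are $1$. **Proposition.** (f) Suppose $\eta=\frac{1}{1+2\sum_{i=0}^{n-1}h_i}=\prod_{i=0}^{n-1}(h_i-1)^2$. Then $h$ is f-composable with rate $\eta$ if and only if there is a vector $v=(v_0,\dots,v_n)$ with nonnegative entries and $\sum_{i=0}^n v_i=\frac1\eta$ such that, for every $d$, every $1$-smooth convex $f:\mathbb{R}^d\to\mathbb{R}$ (with or without a minimizer) and every $x_0\in\mathbb{R}^d$, $$\sum_{i=0}^n v_i\bigl(2(f_i-f_n)+\|g_i\|^2+2\langle g_i,x_0-x_i\rangle\bigr)-\Bigl\|\sum_{i=0}^n v_ig_i\Bigr\|^2\ge 0.$$ (g) Suppose $\eta=\frac{1}{1+2\sum_{i=0}^{n-1}h_i}=\prod_{i=0}^{n-1}(h_i-1)^2$.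 Then $h$ is g-composable with rate $\eta$ if and only if, for every $d$, every $1$-smooth convex $f:\mathbb{R}^d\to\mathbb{R}$ and every $x_0\in\mathbb{R}^d$, $$\eta(f_0-f_n)-\frac{1-\eta}{2}\|g_n\|^2\ge 0.$$ (s) Suppose $\eta=\frac{1}{1+\sum_{i=0}^{n-1}h_i}=\prod_{i=0}^{n-1}(h_i-1)$. Then $h$ is s-composable with rate $\eta$ if and only if, for every $d$, every $1$-smooth convex $f:\mathbb{R}^d\to\mathbb{R}$ and every $x_0\in\mathbb{R}^d$, $$\sum_{i=0}^{n-1}h_i\bigl(2(f_i-f_n)+\|g_i\|^2+2\langle g_i,x_0-x_i\rangle\bigr)-\|x_n-x_0\|^2-\frac{1-\eta}{\eta^2}\|g_n\|^2\ge 0.$$ -/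

import Mathlib

open scoped Gradient

/-- A convex function `f : ℝᵈ → ℝ` that is `1`-smooth: differentiable with `1`-Lipschitz gradient
(with respect to the Euclidean norm). -/
structure IsOneSmoothConvex {d : ℕ} (f : EuclideanSpace ℝ (Fin d) → ℝ) : Prop where
  convexOn : ConvexOn ℝ Set.univ f
  differentiable : Differentiable ℝ f
  lipschitz_gradient : LipschitzWith 1 (∇ f)

/-- The iterates `x₀, x₁, …, xₙ` of gradient descent on `f` with stepsize schedule
`h = (h₀, …, hₙ₋₁)` started at `x₀`: `xᵢ₊₁ = xᵢ - hᵢ ∇f(xᵢ)`. -/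
noncomputable def gdIter {n d : ℕ} (h : Fin n → ℝ) (f : EuclideanSpace ℝ (Fin d) → ℝ)
    (x₀ : EuclideanSpace ℝ (Fin d)) : Fin (n + 1) → EuclideanSpace ℝ (Fin d) :=
  Fin.induction (motive := fun _ => EuclideanSpace ℝ (Fin d)) x₀ (fun i x => x - h i • ∇ f x)

/-- The identities `η = 1 / (1 + 2 ∑ hᵢ) = ∏ (hᵢ - 1)²` for the rate of an f-composable or of a
g-composable schedule. -/
def FGRateIdentity {n : ℕ} (h : Fin n → ℝ) (η : ℝ) : Prop :=
  η = 1 / (1 + 2 * ∑ i, h i) ∧ η = ∏ i, (h i - 1) ^ 2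

/-- The identities `η = 1 / (1 + ∑ hᵢ) = ∏ (hᵢ - 1)` for the rate of an s-composable schedule. -/
def SRateIdentity {n : ℕ} (h : Fin n → ℝ) (η : ℝ) : Prop :=
  η = 1 / (1 + ∑ i, h i) ∧ η = ∏ i, (h i - 1)

/-- The schedule `h` (with positive entries) is f-composable with rate `η`. -/
structure IsFComposable {n : ℕ} (h : Fin n → ℝ) (η : ℝ) : Prop where
  bound : ∀ (d : ℕ) (f : EuclideanSpace ℝ (Fin d) → ℝ), IsOneSmoothConvex f →
    ∀ xs : EuclideanSpace ℝ (Fin d), (∀ y, f xs ≤ f y) → ∀ x₀ : EuclideanSpace ℝ (Fin d),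
      f (gdIter h f x₀ (Fin.last n)) - f xs ≤ η * (‖x₀ - xs‖ ^ 2 / 2)
  rate : FGRateIdentity h η

/-- The schedule `h` (with positive entries) is g-composable with rate `η`. -/
structure IsGComposable {n : ℕ} (h : Fin n → ℝ) (η : ℝ) : Prop where
  bound : ∀ (d : ℕ) (f : EuclideanSpace ℝ (Fin d) → ℝ), IsOneSmoothConvex f →
    ∀ xs : EuclideanSpace ℝ (Fin d), (∀ y, f xs ≤ f y) → ∀ x₀ : EuclideanSpace ℝ (Fin d),
      1 / 2 * ‖∇ f (gdIter h f x₀ (Fin.last n))‖ ^ 2 ≤ η * (f x₀ - f xs)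
  rate : FGRateIdentity h η

/-- The schedule `h` (with positive entries) is s-composable with rate `η`. -/
structure IsSComposable {n : ℕ} (h : Fin n → ℝ) (η : ℝ) : Prop where
  bound : ∀ (d : ℕ) (f : EuclideanSpace ℝ (Fin d) → ℝ), IsOneSmoothConvex f →
    ∀ xs : EuclideanSpace ℝ (Fin d), (∀ y, f xs ≤ f y) → ∀ x₀ : EuclideanSpace ℝ (Fin d),
      (1 - η) / 2 * ‖∇ f (gdIter h f x₀ (Fin.last n))‖ ^ 2
        + η ^ 2 / 2 * ‖gdIter h f x₀ (Fin.last n) - xs‖ ^ 2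
        + (η - η ^ 2) * (f (gdIter h f x₀ (Fin.last n)) - f xs)
        ≤ η ^ 2 / 2 * ‖x₀ - xs‖ ^ 2
  rate : SRateIdentity h η

/-! The "if" directions evaluate the inequality at a minimizer by co-coercivity. In (f) the square
in `x₀ - xs` is then completed; in (s) the weights are the stepsizes, so `∑ hᵢ gᵢ` telescopes to `x₀
- xₙ`.

For "only if", a run on an arbitrary `f`, possibly without minimizer, is turned into a run on a
function with a minimizer, where the composability bound applies. Runs are treated as interpolation
data, which can be scaled and added orthogonally. `IsGDData.exists_function` realizes data together
with a minimizer as the Moreau envelope of a maximum of affine functions and a constant.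

In (f) and (g), the data scaled by `t` is added to a run on the affine part of a Huber function, for
which the bound is an equality; the coefficient of `t ^ 2` is the claim. For (f) the new minimizer
is read off a weight vector that is optimal for the given data. Data sets are convex under
orthogonal sums, so Sion's minimax theorem makes the weights independent of the data.

In (s), if the gradients are linearly independent, a minimizer exists that makes every tangent
inequality tight, and the bound there is the claim. Independence is arranged by adding a small
multiple of a generic quadratic run. -/

/-! ### Inequalities for smooth convex functions -/

section SmoothConvex

variable {d : ℕ} {f : EuclideanSpace ℝ (Fin d) → ℝ}

theorem IsOneSmoothConvex.hasDerivAt_line (hf : IsOneSmoothConvex f)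
    (x v : EuclideanSpace ℝ (Fin d)) (t : ℝ) :
    HasDerivAt (fun s : ℝ => f (x + s • v)) (inner ℝ (∇ f (x + t • v)) v) t := by
  have h1 : HasDerivAt (fun s : ℝ => x + s • v) v t := by
    simpa using ((hasDerivAt_id t).smul_const v).const_add x
  have h2 := (hf.differentiable (x + t • v)).hasGradientAt.hasFDerivAt.comp_hasDerivAt t h1
  simpa [Function.comp_def] using h2

/-- The first-order lower bound for convex functions. -/
theorem IsOneSmoothConvex.add_inner_le (hf : IsOneSmoothConvex f)
    (x y : EuclideanSpace ℝ (Fin d)) : f x + inner ℝ (∇ f x) (y - x) ≤ f y := by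
  have hc : ConvexOn ℝ Set.univ (fun s : ℝ => f (x + s • (y - x))) := by
    have := hf.convexOn.comp_affineMap (AffineMap.lineMap (k := ℝ) x y)
    simpa [Function.comp_def, AffineMap.lineMap_apply, add_comm] using this
  have hd := hf.hasDerivAt_line x (y - x) 0
  have := hc.le_slope_of_hasDerivAt (Set.mem_univ 0) (Set.mem_univ 1) one_pos hd
  simp only [slope_def_field, zero_smul, add_zero, one_smul, add_sub_cancel, sub_zero,
    div_one] at this
  linarith

/-- The quadratic upper bound for functions with a `1`-Lipschitz gradient. -/
theorem IsOneSmoothConvex.le_add_inner_add (hf : IsOneSmoothConvex f)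
    (x y : EuclideanSpace ℝ (Fin d)) :
    f y ≤ f x + inner ℝ (∇ f x) (y - x) + ‖y - x‖ ^ 2 / 2 := by
  set v := y - x with hv
  let φ : ℝ → ℝ := fun t => f (x + t • v) - t * inner ℝ (∇ f x) v - t ^ 2 * (‖v‖ ^ 2 / 2)
  have hφ (t : ℝ) : HasDerivAt φ
      (inner ℝ (∇ f (x + t • v)) v - inner ℝ (∇ f x) v - 2 * t * (‖v‖ ^ 2 / 2)) t := by
    refine ((hf.hasDerivAt_line x v t).sub ?_).sub ?_
    · simpa using (hasDerivAt_id t).mul_const (inner ℝ (∇ f x) v)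
    · simpa using (hasDerivAt_pow 2 t).mul_const (‖v‖ ^ 2 / 2)
  have hanti : AntitoneOn φ (Set.Icc 0 1) := by
    refine antitoneOn_of_deriv_nonpos (convex_Icc 0 1)
      (fun t _ => (hφ t).continuousAt.continuousWithinAt)
      (fun t _ => (hφ t).differentiableAt.differentiableWithinAt) fun t ht => ?_
    rw [interior_Icc] at ht
    rw [(hφ t).deriv, ← inner_sub_left]
    have h1 := real_inner_le_norm (∇ f (x + t • v) - ∇ f x) v
    have h2 := hf.lipschitz_gradient.dist_le_mul (x + t • v) x
    simp only [dist_eq_norm, add_sub_cancel_left, norm_smul, Real.norm_eq_abs, abs_of_pos ht.1,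
      NNReal.coe_one, one_mul] at h2
    nlinarith [norm_nonneg v]
  have := hanti (Set.left_mem_Icc.2 zero_le_one) (Set.right_mem_Icc.2 zero_le_one) zero_le_one
  simp only [φ, one_smul, zero_smul, add_zero, hv, add_sub_cancel] at this
  rw [← hv] at this
  linarith

/-- Co-coercivity of the gradient in its function-value form. -/
theorem IsOneSmoothConvex.add_inner_add_le (hf : IsOneSmoothConvex f)
    (x y : EuclideanSpace ℝ (Fin d)) :
    f y + inner ℝ (∇ f y) (x - y) + ‖∇ f x - ∇ f y‖ ^ 2 / 2 ≤ f x := by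
  set G := ∇ f x - ∇ f y with hG
  -- `x - G` is the gradient step from `x` for `f` minus its tangent at `y`.
  have h1 := hf.le_add_inner_add x (x - G)
  have h2 := hf.add_inner_le y (x - G)
  have h3 : inner ℝ (∇ f x) G - inner ℝ (∇ f y) G = ‖G‖ ^ 2 := by
    rw [← inner_sub_left, ← hG, real_inner_self_eq_norm_sq]
  have h4 : x - G - x = -G := by abel
  have h5 : x - G - y = (x - y) - G := by abel
  rw [h4, norm_neg, inner_neg_right] at h1
  rw [h5, inner_sub_right] at h2
  linarith

theorem gradient_eq_zero_of_forall_le {xs : EuclideanSpace ℝ (Fin d)}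
    (hxs : ∀ y, f xs ≤ f y) : ∇ f xs = 0 := by
  have : IsLocalMin f xs := Filter.Eventually.of_forall hxs
  simp [gradient, this.fderiv_eq_zero]

end SmoothConvex

/-- Replaces the limit `t → 0` in first-order optimality conditions and perturbation arguments. -/
theorem nonpos_of_forall_le_mul {a b : ℝ} (hb : 0 ≤ b)
    (hab : ∀ t : ℝ, 0 < t → t ≤ 1 → a ≤ t * b) : a ≤ 0 := by
  by_contra! ha
  have h := hab (a / (a + b)) (by positivity) (div_le_one_of_le₀ (by linarith) (by positivity))
  rw [div_mul_eq_mul_div, le_div_iff₀ (by positivity)] at h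
  nlinarith

/-! ### Proximal points and Moreau envelopes -/

section Moreau

variable {d : ℕ} {ψ : EuclideanSpace ℝ (Fin d) → ℝ}

theorem exists_isProx (hc : Continuous ψ) {m : ℝ} (hm : ∀ z, m ≤ ψ z)
    (x : EuclideanSpace ℝ (Fin d)) :
    ∃ p, ∀ z, ψ p + ‖x - p‖ ^ 2 / 2 ≤ ψ z + ‖x - z‖ ^ 2 / 2 := by
  refine Continuous.exists_forall_le (f := fun z => ψ z + ‖x - z‖ ^ 2 / 2) (by fun_prop) ?_
  have h1 : Filter.Tendsto (fun z => ‖x - z‖) (Filter.cocompact _) Filter.atTop := by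
    simp only [← dist_eq_norm]
    exact tendsto_dist_left_cocompact_atTop x
  have h2 : Filter.Tendsto (fun z => m + ‖x - z‖ ^ 2 / 2)
      (Filter.cocompact (EuclideanSpace ℝ (Fin d))) Filter.atTop :=
    Filter.tendsto_atTop_add_const_left _ _
      (((Filter.tendsto_pow_atTop two_ne_zero).comp h1).atTop_div_const two_pos)
  exact Filter.tendsto_atTop_mono (fun z => by linarith [hm z]) h2

theorem add_inner_le_of_isProx (hψ : ConvexOn ℝ Set.univ ψ) {x p : EuclideanSpace ℝ (Fin d)}
    (hp : ∀ z, ψ p + ‖x - p‖ ^ 2 / 2 ≤ ψ z + ‖x - z‖ ^ 2 / 2) (z : EuclideanSpace ℝ (Fin d)) :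
    ψ p + inner ℝ (x - p) (z - p) ≤ ψ z := by
  have key (t : ℝ) (ht0 : 0 < t) (ht1 : t ≤ 1) :
      ψ p + inner ℝ (x - p) (z - p) - ψ z ≤ t * (‖z - p‖ ^ 2 / 2) := by
    have h1 := hψ.2 (Set.mem_univ p) (Set.mem_univ z) (sub_nonneg.2 ht1) ht0.le (by ring)
    have h2 := hp ((1 - t) • p + t • z)
    have h3 : x - ((1 - t) • p + t • z) = (x - p) - t • (z - p) := by module
    rw [h3, norm_sub_sq_real (x - p), inner_smul_right, norm_smul, mul_pow, Real.norm_eq_abs,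
      sq_abs] at h2
    simp only [smul_eq_mul] at h1
    have : t * (ψ p + inner ℝ (x - p) (z - p) - ψ z) ≤ t * (t * (‖z - p‖ ^ 2 / 2)) := by
      linarith
    exact le_of_mul_le_mul_left this ht0
  linarith [nonpos_of_forall_le_mul (by positivity) key]

/-- The Moreau envelope of a convex continuous function that is bounded below is `1`-smooth and
convex; its gradient at `q + g` is `g` whenever `g` is a subgradient at `q`. -/
theorem exists_moreauEnvelope (hψ : ConvexOn ℝ Set.univ ψ) (hc : Continuous ψ) {m : ℝ}
    (hm : ∀ z, m ≤ ψ z) :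
    ∃ f : EuclideanSpace ℝ (Fin d) → ℝ, IsOneSmoothConvex f ∧ (∀ z, m ≤ f z) ∧
      ∀ q g, (∀ z, ψ q + inner ℝ g (z - q) ≤ ψ z) →
        f (q + g) = ψ q + ‖g‖ ^ 2 / 2 ∧ ∇ f (q + g) = g := by
  choose p hp using exists_isProx hc hm
  have hsub x z := add_inner_le_of_isProx hψ (hp x) z
  set f : EuclideanSpace ℝ (Fin d) → ℝ := fun x => ψ (p x) + ‖x - p x‖ ^ 2 / 2 with hf
  -- The old proximal point `p x` competes in the problem at `y`.
  have hup (x y) : f y ≤ f x + inner ℝ (x - p x) (y - x) + ‖y - x‖ ^ 2 / 2 := by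
    have h1 := hp y (p x)
    have h2 : y - p x = (x - p x) + (y - x) := by abel
    rw [h2, norm_add_sq_real] at h1
    simp only [hf]
    linarith
  -- The subgradient inequality at `p x` is tested at `p y`; it yields convexity and, symmetrized,
  -- the Lipschitz bound.
  have hlow (x y) : f x + inner ℝ (x - p x) (y - x) + ‖(x - p x) - (y - p y)‖ ^ 2 / 2 ≤ f y := by
    have h1 := hsub x (p y)
    have h2 : p y - p x = (y - x) + (x - p x) - (y - p y) := by abel
    rw [h2, inner_sub_right, inner_add_right, real_inner_self_eq_norm_sq] at h1
    rw [norm_sub_sq_real (x - p x)]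
    simp only [hf]
    linarith
  have hgrad (x) : HasGradientAt f (x - p x) x := by
    rw [hasGradientAt_iff_isLittleO]
    have hO : (fun y => f y - f x - inner ℝ (x - p x) (y - x))
        =O[nhds x] fun y => ‖y - x‖ ^ 2 := by
      refine Asymptotics.IsBigO.of_bound 1 (Filter.Eventually.of_forall fun y => ?_)
      have h1 := hup x y
      have h2 := hlow x y
      have h3 := sq_nonneg ‖(x - p x) - (y - p y)‖
      have h4 := sq_nonneg ‖y - x‖
      rw [Real.norm_eq_abs, Real.norm_eq_abs, abs_of_nonneg h4, abs_le]
      constructor <;> linarith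
    refine hO.trans_isLittleO ?_
    have h0 : Filter.Tendsto (fun y => y - x) (nhds x) (nhds 0) := by
      simpa using (continuous_sub_right x).tendsto x
    exact (Asymptotics.isLittleO_norm_pow_id one_lt_two).comp_tendsto h0
  have hg : ∇ f = fun x => x - p x := gradient_eq hgrad
  refine ⟨f, ⟨?_, fun x => (hgrad x).differentiableAt, ?_⟩, ?_, ?_⟩
  · refine ⟨convex_univ, fun x _ y _ a b ha hb hab => ?_⟩
    set z := a • x + b • y with hz
    have h1 := hlow z x
    have h2 := hlow z y
    have h3 := sq_nonneg ‖(z - p z) - (x - p x)‖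
    have h4 := sq_nonneg ‖(z - p z) - (y - p y)‖
    have h5 : a * inner ℝ (z - p z) (x - z) + b * inner ℝ (z - p z) (y - z) = 0 := by
      rw [← inner_smul_right, ← inner_smul_right, ← inner_add_right]
      have : a • (x - z) + b • (y - z) = 0 := by
        have : a • (x - z) + b • (y - z) = (a • x + b • y) - (a + b) • z := by module
        rw [this, hab, one_smul, hz, sub_self]
      rw [this, inner_zero_right]
    have h6 := mul_le_mul_of_nonneg_left (show f z + inner ℝ (z - p z) (x - z) ≤ f x by linarith) ha
    have h7 := mul_le_mul_of_nonneg_left (show f z + inner ℝ (z - p z) (y - z) ≤ f y by linarith) hb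
    have h8 : a * f z + b * f z = f z := by rw [← add_mul, hab, one_mul]
    simp only [smul_eq_mul]
    linarith
  · rw [hg]
    refine LipschitzWith.of_dist_le_mul fun x y => ?_
    simp only [dist_eq_norm, NNReal.coe_one, one_mul]
    have h1 := hlow x y
    have h2 := hlow y x
    rw [norm_sub_rev (y - p y)] at h2
    have h3 : inner ℝ (x - p x) (y - x) + inner ℝ (y - p y) (x - y)
        = -inner ℝ ((x - p x) - (y - p y)) (x - y) := by
      rw [← neg_sub x y, inner_neg_right, inner_sub_left (x - p x)]; ring
    have h4 := real_inner_le_norm ((x - p x) - (y - p y)) (x - y)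
    by_contra! hlt
    nlinarith [norm_nonneg (x - y)]
  · intro z
    have := hm (p z)
    simp only [hf]
    nlinarith [sq_nonneg ‖z - p z‖]
  · intro q g hq
    -- Monotonicity of the subdifferential: `g` is a subgradient at `q`, and `q + g - p (q + g)` is
    -- one at the proximal point.
    have hpq : p (q + g) = q := by
      have h1 := hsub (q + g) q
      have h2 := hq (p (q + g))
      have h3 : inner ℝ (q + g - p (q + g)) (q - p (q + g)) + inner ℝ g (p (q + g) - q)
          = ‖q - p (q + g)‖ ^ 2 := by
        rw [← neg_sub q (p (q + g)), inner_neg_right, ← sub_eq_add_neg, ← inner_sub_left,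
          ← real_inner_self_eq_norm_sq]
        congr 1; abel
      have h4 : ‖q - p (q + g)‖ ^ 2 ≤ 0 := by linarith
      have h5 : ‖q - p (q + g)‖ = 0 := by nlinarith [norm_nonneg (q - p (q + g))]
      exact (sub_eq_zero.1 (norm_eq_zero.1 h5)).symm
    exact ⟨by simp [hf, hpq], by simp [hg, hpq]⟩

end Moreau

/-- Points `x`, gradients `g` and function values `F` along a run of gradient descent with
stepsizes `h`, subject to the interpolation inequalities of `1`-smooth convex functions. -/
structure IsGDData {n : ℕ} (h : Fin n → ℝ) {E : Type*} [NormedAddCommGroup E]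
    [InnerProductSpace ℝ E] (x g : Fin (n + 1) → E) (F : Fin (n + 1) → ℝ) : Prop where
  step : ∀ i : Fin n, x i.succ = x i.castSucc - h i • g i.castSucc
  interp : ∀ i j, F j + inner ℝ (g j) (x i - x j) + ‖g i - g j‖ ^ 2 / 2 ≤ F i

/-! ### Interpolation data and its realization by functions -/

section GDData

variable {n d : ℕ} {h : Fin n → ℝ}

@[simp]
theorem gdIter_zero (f : EuclideanSpace ℝ (Fin d) → ℝ) (x₀ : EuclideanSpace ℝ (Fin d)) :
    gdIter h f x₀ 0 = x₀ := rfl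

theorem gdIter_succ (f : EuclideanSpace ℝ (Fin d) → ℝ) (x₀ : EuclideanSpace ℝ (Fin d))
    (i : Fin n) : gdIter h f x₀ i.succ
      = gdIter h f x₀ i.castSucc - h i • ∇ f (gdIter h f x₀ i.castSucc) := by
  simp [gdIter]

theorem IsOneSmoothConvex.isGDData {f : EuclideanSpace ℝ (Fin d) → ℝ} (hf : IsOneSmoothConvex f)
    (h : Fin n → ℝ) (x₀ : EuclideanSpace ℝ (Fin d)) :
    IsGDData h (gdIter h f x₀) (fun i => ∇ f (gdIter h f x₀ i)) (fun i => f (gdIter h f x₀ i)) :=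
  ⟨gdIter_succ f x₀, fun _ _ => hf.add_inner_add_le _ _⟩

variable {E E' : Type*} [NormedAddCommGroup E] [InnerProductSpace ℝ E] [NormedAddCommGroup E']
  [InnerProductSpace ℝ E'] {x g : Fin (n + 1) → E} {F : Fin (n + 1) → ℝ}

theorem IsGDData.map (hD : IsGDData h x g F) (e : E →ₗᵢ[ℝ] E') :
    IsGDData h (fun i => e (x i)) (fun i => e (g i)) F :=
  ⟨fun i => by simp [hD.step], fun i j => by
    simpa only [← map_sub, e.inner_map_map, e.norm_map] using hD.interp i j⟩

theorem IsGDData.smul (hD : IsGDData h x g F) (t : ℝ) :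
    IsGDData h (fun i => t • x i) (fun i => t • g i) (fun i => t ^ 2 * F i) :=
  ⟨fun i => by simp only [hD.step, smul_sub, smul_comm t], fun i j => by
    have := mul_le_mul_of_nonneg_left (hD.interp i j) (sq_nonneg t)
    simp only [← smul_sub, norm_smul, mul_pow, inner_smul_left, inner_smul_right, Real.norm_eq_abs,
      sq_abs, conj_trivial]
    linarith⟩

/-- Inner products and squared norms add over orthogonal sums. All perturbations, and the convexity
needed for minimax, rest on this. -/
theorem IsGDData.prod (hD : IsGDData h x g F) {x' g' : Fin (n + 1) → E'} {F' : Fin (n + 1) → ℝ}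
    (hD' : IsGDData h x' g' F') :
    IsGDData h (fun i => WithLp.toLp 2 (x i, x' i)) (fun i => WithLp.toLp 2 (g i, g' i))
      (fun i => F i + F' i) :=
  ⟨fun i => by simp [hD.step, hD'.step, ← WithLp.toLp_smul, ← WithLp.toLp_sub], fun i j => by
    have h1 := hD.interp i j
    have h2 := hD'.interp i j
    simp only [WithLp.prod_inner_apply, ← WithLp.toLp_sub, Prod.mk_sub_mk,
      WithLp.prod_norm_sq_eq_of_L2, WithLp.toLp_fst, WithLp.toLp_snd]
    linarith⟩

/-- Interpolation data whose affine minorants stay below `m` at `xs`, and whose values allow the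
minimal value `m`, come from a `1`-smooth convex function with a minimizer. -/
theorem IsGDData.exists_function_aux {x g : Fin (n + 1) → EuclideanSpace ℝ (Fin d)}
    (hD : IsGDData h x g F) {xs : EuclideanSpace ℝ (Fin d)} {m : ℝ}
    (hle : ∀ i, F i + inner ℝ (g i) (xs - x i) + ‖g i‖ ^ 2 / 2 ≤ m)
    (hge : ∀ i, m ≤ F i - ‖g i‖ ^ 2 / 2) :
    ∃ f : EuclideanSpace ℝ (Fin d) → ℝ, IsOneSmoothConvex f ∧ (∀ y, f xs ≤ f y) ∧ f xs = m ∧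
      (∀ i, gdIter h f (x 0) i = x i) ∧ ∀ i, f (x i) = F i ∧ ∇ f (x i) = g i := by
  -- The envelope of an affine function of slope `g i` lies `‖g i‖ ^ 2 / 2` below it, so the
  -- tangents are raised by that amount.
  let a : Fin (n + 1) → EuclideanSpace ℝ (Fin d) → ℝ := fun i z =>
    F i + inner ℝ (g i) (z - x i) + ‖g i‖ ^ 2 / 2
  let ψ : EuclideanSpace ℝ (Fin d) → ℝ :=
    fun z => max m (Finset.univ.sup' Finset.univ_nonempty fun i => a i z)
  have ha (i z) : a i z ≤ ψ z :=
    le_max_of_le_right (Finset.le_sup' (fun i => a i z) (Finset.mem_univ i))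
  have hψ_le {z c} (hm : m ≤ c) (hc : ∀ i, a i z ≤ c) : ψ z ≤ c :=
    max_le hm (Finset.sup'_le _ _ fun i _ => hc i)
  have hconv : ConvexOn ℝ Set.univ ψ := by
    refine ⟨convex_univ, fun y _ z _ s t hs ht hst => ?_⟩
    simp only [smul_eq_mul]
    refine hψ_le ?_ fun i => ?_
    · have h1 : m ≤ ψ y := le_max_left _ _
      have h2 : m ≤ ψ z := le_max_left _ _
      have : m = s * m + t * m := by rw [← add_mul, hst, one_mul]
      nlinarith
    · have h1 := mul_le_mul_of_nonneg_left (ha i y) hs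
      have h2 := mul_le_mul_of_nonneg_left (ha i z) ht
      have h3 : a i (s • y + t • z) = s * a i y + t * a i z := by
        obtain rfl : t = 1 - s := by linarith
        simp only [a, inner_sub_right, inner_add_right, inner_smul_right]
        ring
      linarith
  have hcont : Continuous ψ := by
    refine continuous_const.max (Continuous.finset_sup'_apply _ fun i _ => ?_)
    fun_prop
  obtain ⟨f, hf, hm, hval⟩ := exists_moreauEnvelope hconv hcont (m := m) fun z => le_max_left _ _
  have hψxs : ψ xs = m := le_antisymm (hψ_le le_rfl hle) (le_max_left _ _)
  have hxs := hval xs 0 fun z => by simp [hψxs, ψ]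
  simp only [add_zero, norm_zero] at hxs
  have hfx (i) : f (x i) = F i ∧ ∇ f (x i) = g i := by
    -- The interpolation inequality for `i, j` says exactly that `a j` is at most this value at `x i
    -- - g i`; `a i` attains it.
    have hψi : ψ (x i - g i) = F i - ‖g i‖ ^ 2 / 2 := by
      refine le_antisymm (hψ_le (hge i) fun j => ?_) ?_
      · have h1 := hD.interp i j
        have h2 : x i - g i - x j = (x i - x j) - g i := by abel
        simp only [a]
        rw [norm_sub_sq_real, real_inner_comm (g j) (g i)] at h1
        rw [h2, inner_sub_right]
        linarith
      · have h1 := ha i (x i - g i)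
        have h2 : x i - g i - x i = -g i := by abel
        simp only [a] at h1
        rw [h2, inner_neg_right, real_inner_self_eq_norm_sq] at h1
        linarith
    have h1 := hval (x i - g i) (g i) fun z => by
      rw [hψi]
      have h1 := ha i z
      have h2 : z - (x i - g i) = (z - x i) + g i := by abel
      simp only [a] at h1
      rw [h2, inner_add_right, real_inner_self_eq_norm_sq]
      linarith
    rw [sub_add_cancel, hψi] at h1
    exact ⟨by linarith [h1.1], h1.2⟩
  have hfxs : f xs = m := by rw [hxs.1, hψxs]; norm_num
  refine ⟨f, hf, fun y => hfxs ▸ hm y, hfxs, fun i => ?_, hfx⟩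
  induction i using Fin.induction with
  | zero => rfl
  | succ i ih => rw [gdIter_succ, ih, (hfx _).2, hD.step]

theorem IsGDData.exists_function [FiniteDimensional ℝ E] (hD : IsGDData h x g F) {xs : E} {m : ℝ}
    (hle : ∀ i, F i + inner ℝ (g i) (xs - x i) + ‖g i‖ ^ 2 / 2 ≤ m)
    (hge : ∀ i, m ≤ F i - ‖g i‖ ^ 2 / 2) :
    ∃ (d : ℕ) (f : EuclideanSpace ℝ (Fin d) → ℝ) (x₀ ys : EuclideanSpace ℝ (Fin d)),
      IsOneSmoothConvex f ∧ (∀ y, f ys ≤ f y) ∧ f ys = m ∧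
      ∀ i, f (gdIter h f x₀ i) = F i ∧ ‖∇ f (gdIter h f x₀ i)‖ = ‖g i‖ ∧
        ‖gdIter h f x₀ i - ys‖ = ‖x i - xs‖ := by
  let e := (stdOrthonormalBasis ℝ E).repr.toLinearIsometry
  obtain ⟨f, hf, hmin, hm, hiter, hval⟩ := (hD.map e).exists_function_aux (xs := e xs) (m := m)
    (fun i => by simpa only [← map_sub, e.inner_map_map, e.norm_map] using hle i)
    (fun i => by simpa only [e.norm_map] using hge i)
  refine ⟨_, f, e (x 0), e xs, hf, hmin, hm, fun i => ?_⟩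
  rw [hiter, (hval i).1, (hval i).2, ← map_sub, e.norm_map, e.norm_map]
  exact ⟨rfl, rfl, rfl⟩

end GDData

/-! ### The Huber run -/

section StepSum

variable {n : ℕ} {h : Fin n → ℝ}

/-- The sum of the stepsizes used before the `i`-th iterate. -/
def stepSum (h : Fin n → ℝ) (i : Fin (n + 1)) : ℝ :=
  ∑ j with Fin.castSucc j < i, h j

theorem filter_castSucc_lt_succ (i : Fin n) :
    (Finset.univ.filter fun j : Fin n => j.castSucc < i.succ)
      = insert i (Finset.univ.filter fun j : Fin n => j.castSucc < i.castSucc) := by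
  ext j
  simp [le_iff_eq_or_lt]

theorem stepSum_succ (i : Fin n) : stepSum h i.succ = stepSum h i.castSucc + h i := by
  rw [stepSum, filter_castSucc_lt_succ, Finset.sum_insert (by simp), stepSum, add_comm]

theorem stepSum_zero : stepSum h 0 = 0 := by simp [stepSum]

theorem stepSum_last : stepSum h (Fin.last n) = ∑ i, h i := by
  simp [stepSum, Fin.castSucc_lt_last]

theorem stepSum_le (hpos : ∀ i, 0 < h i) (i : Fin (n + 1)) : stepSum h i ≤ ∑ j, h j :=
  Finset.sum_le_sum_of_subset_of_nonneg (Finset.filter_subset _ _) fun j _ _ => (hpos j).le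

theorem stepSum_castSucc_lt (hpos : ∀ i, 0 < h i) (i : Fin n) :
    stepSum h i.castSucc < ∑ j, h j := by
  have h1 := stepSum_le hpos i.succ
  rw [stepSum_succ] at h1
  linarith [hpos i]

/-- Gradient descent on the affine part of a Huber function. -/
theorem isGDData_affine (h : Fin n → ℝ) (u : ℝ) :
    IsGDData h (fun i => u - stepSum h i) (fun _ => (1 : ℝ)) (fun i => u - stepSum h i - 1 / 2) :=
  ⟨fun i => by simp only [stepSum_succ, smul_eq_mul]; ring, fun i j => by simp; linarith⟩

end StepSum

/-- Finitely many positive slacks absorb a perturbation of order `t ^ 2`; where the slack may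
vanish, the perturbation has the right sign. -/
theorem exists_pos_forall_add_sq_mul_nonneg {ι : Type*} [Finite ι] {σ c : ι → ℝ}
    (hσ : ∀ i, 0 < σ i ∨ (0 ≤ σ i ∧ 0 ≤ c i)) : ∃ t : ℝ, 0 < t ∧ ∀ i, 0 ≤ σ i + t ^ 2 * c i := by
  have hev : ∀ᶠ t : ℝ in nhdsWithin 0 (Set.Ioi 0), ∀ i, 0 ≤ σ i + t ^ 2 * c i := by
    refine Filter.eventually_all.2 fun i => ?_
    rcases hσ i with hi | ⟨h0, h1⟩
    · have hcont : Filter.Tendsto (fun t : ℝ => σ i + t ^ 2 * c i) (nhds 0) (nhds (σ i)) := by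
        have : Continuous fun t : ℝ => σ i + t ^ 2 * c i := by fun_prop
        simpa using this.tendsto 0
      exact ((hcont.eventually (lt_mem_nhds hi)).filter_mono nhdsWithin_le_nhds).mono
        fun t ht => ht.le
    · exact Filter.Eventually.of_forall fun t => by positivity
  obtain ⟨t, ht, htpos⟩ := (hev.and self_mem_nhdsWithin).exists
  exact ⟨t, htpos, ht⟩

/-! ### Perturbing the Huber run -/

section Perturbation

variable {n : ℕ} {h : Fin n → ℝ} {E : Type*} [NormedAddCommGroup E] [InnerProductSpace ℝ E]
  [FiniteDimensional ℝ E] {x g : Fin (n + 1) → E} {F : Fin (n + 1) → ℝ}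

/-- Adding the affine part of a Huber function to a small multiple of the data makes room for a
minimizer. -/
theorem IsGDData.exists_function_add_affine (hD : IsGDData h x g F) {xs : E} {m : ℝ}
    (hle : ∀ i, F i + inner ℝ (g i) (xs - x i) + ‖g i‖ ^ 2 / 2 ≤ m) (u : ℝ)
    (hu : ∀ i, 0 < u - stepSum h i - 1 ∨
      (0 ≤ u - stepSum h i - 1 ∧ 0 ≤ F i - ‖g i‖ ^ 2 / 2 - m)) :
    ∃ t : ℝ, 0 < t ∧ ∃ (d : ℕ) (f : EuclideanSpace ℝ (Fin d) → ℝ)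
      (x₀ ys : EuclideanSpace ℝ (Fin d)),
      IsOneSmoothConvex f ∧ (∀ y, f ys ≤ f y) ∧ f ys = t ^ 2 * m ∧
      ∀ i, f (gdIter h f x₀ i) = u - stepSum h i - 1 / 2 + t ^ 2 * F i ∧
        ‖∇ f (gdIter h f x₀ i)‖ ^ 2 = 1 + t ^ 2 * ‖g i‖ ^ 2 ∧
        ‖gdIter h f x₀ i - ys‖ ^ 2 = (u - stepSum h i) ^ 2 + t ^ 2 * ‖x i - xs‖ ^ 2 := by
  obtain ⟨t, ht, hslack⟩ := exists_pos_forall_add_sq_mul_nonneg hu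
  have hsq (a b : ℝ) (y z : E) :
      ‖WithLp.toLp 2 (a, t • y) - WithLp.toLp 2 (b, t • z)‖ ^ 2
        = (a - b) ^ 2 + t ^ 2 * ‖y - z‖ ^ 2 := by
    simp [← WithLp.toLp_sub, WithLp.prod_norm_sq_eq_of_L2, ← smul_sub, norm_smul, mul_pow]
  have hsq0 (a : ℝ) (y : E) : ‖WithLp.toLp 2 (a, t • y)‖ ^ 2 = a ^ 2 + t ^ 2 * ‖y‖ ^ 2 := by
    simp [WithLp.prod_norm_sq_eq_of_L2, norm_smul, mul_pow]
  obtain ⟨d, f, x₀, ys, hf, hmin, hys, hval⟩ :=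
    ((isGDData_affine h u).prod (hD.smul t)).exists_function
      (xs := WithLp.toLp 2 ((0 : ℝ), t • xs)) (m := t ^ 2 * m)
      -- The raised tangents of the affine run vanish at `0`, so only `hle` times `t ^ 2` remains.
      (fun i => by
        have h1 := mul_le_mul_of_nonneg_left (hle i) (sq_nonneg t)
        rw [hsq0]
        simp only [WithLp.prod_inner_apply, ← WithLp.toLp_sub, Prod.mk_sub_mk, ← smul_sub, inner_smul_left, inner_smul_right, conj_trivial,
          RCLike.inner_apply]
        linarith)
      (fun i => by
        have h1 := hslack i
        rw [hsq0]
        linarith)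
  refine ⟨t, ht, d, f, x₀, ys, hf, hmin, hys, fun i => ?_⟩
  obtain ⟨h1, h2, h3⟩ := hval i
  rw [h1, h2, h3, hsq0, hsq]
  simp

end Perturbation

/-! ### g-composability -/

section G

variable {n : ℕ} {h : Fin n → ℝ} {η : ℝ}

theorem IsGComposable.nonneg (hpos : ∀ i, 0 < h i) (hg : IsGComposable h η) {d : ℕ}
    {f : EuclideanSpace ℝ (Fin d) → ℝ} (hf : IsOneSmoothConvex f)
    (x₀ : EuclideanSpace ℝ (Fin d)) :
    0 ≤ η * (f x₀ - f (gdIter h f x₀ (Fin.last n)))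
      - (1 - η) / 2 * ‖∇ f (gdIter h f x₀ (Fin.last n))‖ ^ 2 := by
  have hD := hf.isGDData h x₀
  set l := Fin.last n
  obtain ⟨t, ht, d', f', y₀, ys, hf', hmin, hys, hval⟩ := hD.exists_function_add_affine
    -- A unit gradient step from the last iterate. Interpolation bounds every raised tangent there
    -- by `m`, with equality for the last one.
    (xs := gdIter h f x₀ l - ∇ f (gdIter h f x₀ l))
    (m := f (gdIter h f x₀ l) - ‖∇ f (gdIter h f x₀ l)‖ ^ 2 / 2)
    (fun i => by
      have h1 := hD.interp l i
      rw [sub_right_comm, inner_sub_right]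
      rw [norm_sub_sq_real, real_inner_comm (∇ f (gdIter h f x₀ i)) (∇ f (gdIter h f x₀ l))] at h1
      linarith)
    -- The Huber run then ends at `1`, the edge of the affine part, where the g-bound is tight; the
    -- last slack is zero.
    (1 + ∑ i, h i)
    (fun i => by
      induction i using Fin.lastCases with
      | last => exact Or.inr ⟨by simp [stepSum_last], by simp [l]⟩
      | cast i => exact Or.inl (by linarith [stepSum_castSucc_lt hpos i]))
  have hb := hg.bound d' f' hf' ys hmin y₀
  have h0 := (hval 0).1
  rw [gdIter_zero, stepSum_zero, gdIter_zero] at h0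
  rw [(hval l).2.1, h0, hys] at hb
  have hS : 0 ≤ ∑ i, h i := Finset.sum_nonneg fun i _ => (hpos i).le
  have hη : η * (1 + 2 * ∑ i, h i) = 1 := by
    rw [hg.rate.1, one_div_mul_cancel (by positivity)]
  refine nonneg_of_mul_nonneg_right (a := t ^ 2) ?_ (by positivity)
  linarith

theorem isGComposable_of_nonneg (hη : 0 ≤ η) (hr : FGRateIdentity h η)
    (H : ∀ (d : ℕ) (f : EuclideanSpace ℝ (Fin d) → ℝ), IsOneSmoothConvex f →
      ∀ x₀ : EuclideanSpace ℝ (Fin d), 0 ≤ η * (f x₀ - f (gdIter h f x₀ (Fin.last n)))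
        - (1 - η) / 2 * ‖∇ f (gdIter h f x₀ (Fin.last n))‖ ^ 2) : IsGComposable h η := by
  refine ⟨fun d f hf xs hxs x₀ => ?_, hr⟩
  have h1 := H d f hf x₀
  have h2 := hf.add_inner_add_le (gdIter h f x₀ (Fin.last n)) xs
  rw [gradient_eq_zero_of_forall_le hxs] at h2
  simp only [inner_zero_left, sub_zero, add_zero] at h2
  nlinarith

end G

/-! ### f-composability: weights for given data, and minimax -/

section F

variable {n : ℕ} {h : Fin n → ℝ} {η : ℝ} {E : Type*} [NormedAddCommGroup E]
  [InnerProductSpace ℝ E] {x g : Fin (n + 1) → E} {F : Fin (n + 1) → ℝ}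

/-- If a concave quadratic function `∑ vᵢ aᵢ - ‖∑ vᵢ gᵢ‖²` is maximal at `v` along the segment to
`w`, its derivative at `v` towards `w` is nonpositive. -/
theorem sum_mul_sub_inner_le_of_isMaxOn {ι : Type*} [Fintype ι] {X : Set (ι → ℝ)}
    (hX : Convex ℝ X) {a : ι → ℝ} {g : ι → E} {v w : ι → ℝ} (hv : v ∈ X) (hw : w ∈ X)
    (hmax : IsMaxOn (fun v => ∑ i, v i * a i - ‖∑ i, v i • g i‖ ^ 2) X v) :
    ∑ i, w i * a i - 2 * inner ℝ (∑ i, v i • g i) (∑ i, w i • g i)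
      ≤ ∑ i, v i * a i - 2 * ‖∑ i, v i • g i‖ ^ 2 := by
  set s := ∑ i, v i • g i with hs
  set r := ∑ i, w i • g i with hr
  rw [← sub_nonpos]
  refine nonpos_of_forall_le_mul (sq_nonneg ‖r - s‖) fun t ht0 ht1 => ?_
  have h1 := hmax (hX.add_smul_sub_mem hv hw ⟨ht0.le, ht1⟩)
  have h2 : ∑ i, (v + t • (w - v)) i • g i = s + t • (r - s) := by
    rw [hs, hr, ← Finset.sum_sub_distrib, Finset.smul_sum, ← Finset.sum_add_distrib]
    refine Finset.sum_congr rfl fun i _ => ?_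
    simp only [Pi.add_apply, Pi.smul_apply, Pi.sub_apply, smul_eq_mul]
    module
  have h3 : ∑ i, (v + t • (w - v)) i * a i
      = ∑ i, v i * a i + t * (∑ i, w i * a i - ∑ i, v i * a i) := by
    rw [← Finset.sum_sub_distrib, Finset.mul_sum, ← Finset.sum_add_distrib]
    refine Finset.sum_congr rfl fun i _ => ?_
    simp only [Pi.add_apply, Pi.smul_apply, Pi.sub_apply, smul_eq_mul]
    ring
  simp only [Set.mem_ofPred_eq, h2, h3] at h1
  rw [norm_add_sq_real s, norm_smul, mul_pow, Real.norm_eq_abs, sq_abs, inner_smul_right,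
    inner_sub_right, real_inner_self_eq_norm_sq] at h1
  refine le_of_mul_le_mul_left ?_ ht0
  linarith

/-- The coefficient of `vᵢ` in the linear part of the certificate for f-composability. -/
def certCoeff (x g : Fin (n + 1) → E) (F : Fin (n + 1) → ℝ) (i : Fin (n + 1)) : ℝ :=
  2 * (F i - F (Fin.last n)) + ‖g i‖ ^ 2 + 2 * inner ℝ (g i) (x 0 - x i)

theorem isCompact_smul_stdSimplex (c : ℝ) (ι : Type*) [Fintype ι] :
    IsCompact ((fun v : ι → ℝ => c • v) '' stdSimplex ℝ ι) :=
  (isCompact_stdSimplex ℝ ι).image (continuous_const_smul c)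

theorem convex_smul_stdSimplex (c : ℝ) (ι : Type*) [Fintype ι] :
    Convex ℝ ((fun v : ι → ℝ => c • v) '' stdSimplex ℝ ι) :=
  (convex_stdSimplex ℝ ι).smul c

/-- The weights may depend on the data here. Optimality of `v` against each vertex of the scaled
simplex says that all raised tangents are at most `m` at `x 0 - s`; the perturbed f-bound then reads
`0 ≤ L`. -/
theorem IsFComposable.exists_nonneg_of_isGDData [FiniteDimensional ℝ E] (hpos : ∀ i, 0 < h i)
    (hη : 0 < η) (hf : IsFComposable h η) (hn : 0 < n) (hD : IsGDData h x g F) :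
    ∃ v ∈ (fun v : Fin (n + 1) → ℝ => (1 / η) • v) '' stdSimplex ℝ (Fin (n + 1)),
      0 ≤ ∑ i, v i * certCoeff x g F i - ‖∑ i, v i • g i‖ ^ 2 := by
  classical
  obtain ⟨v, hvX, hv⟩ := (isCompact_smul_stdSimplex (1 / η) (Fin (n + 1))).exists_isMaxOn
    (Set.Nonempty.image _ ⟨_, single_mem_stdSimplex ℝ 0⟩)
    (f := fun v => ∑ i, v i * certCoeff x g F i - ‖∑ i, v i • g i‖ ^ 2)
    (Continuous.continuousOn (by fun_prop))
  refine ⟨v, hvX, ?_⟩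
  by_contra! hneg
  set s := ∑ i, v i • g i with hs
  set L := ∑ i, v i * certCoeff x g F i - ‖s‖ ^ 2 with hL
  obtain ⟨t, ht, d, f, x₀, ys, hf', hmin, hys, hval⟩ := hD.exists_function_add_affine
    (xs := x 0 - s) (m := F (Fin.last n) + η / 2 * (L - ‖s‖ ^ 2))
    (fun i => by
      have h1 := sum_mul_sub_inner_le_of_isMaxOn (convex_smul_stdSimplex _ _) hvX
        ⟨_, single_mem_stdSimplex ℝ i, rfl⟩ hv
      simp only [Pi.smul_apply, Pi.single_apply, smul_eq_mul, mul_ite, mul_one, mul_zero, ite_mul,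
        zero_mul, ite_smul, zero_smul, Finset.sum_ite_eq', Finset.mem_univ, if_true, ← hs,
        inner_smul_right] at h1
      have h2 := mul_le_mul_of_nonneg_left h1 hη.le
      have h3 : η * (1 / η * certCoeff x g F i - 2 * (1 / η * inner ℝ s (g i)))
          = certCoeff x g F i - 2 * inner ℝ s (g i) := by field_simp
      rw [h3, real_inner_comm] at h2
      rw [sub_right_comm, inner_sub_right]
      simp only [certCoeff] at h2
      simp only [hL, certCoeff]
      linarith)
    -- This start, equal to `1 / η`, makes the f-bound tight for the Huber run. All slacks are
    -- positive because `0 < n`.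
    (1 + 2 * ∑ i, h i)
    (fun i => Or.inl (by
      have : Nonempty (Fin n) := ⟨⟨0, hn⟩⟩
      have h1 : 0 < ∑ i, h i := Finset.sum_pos (fun i _ => hpos i) Finset.univ_nonempty
      linarith [stepSum_le hpos i]))
  have hb := hf.bound d f hf' ys hmin x₀
  have h0 := (hval 0).2.2
  rw [gdIter_zero, stepSum_zero, sub_sub_cancel] at h0
  rw [h0, (hval (Fin.last n)).1, hys, stepSum_last] at hb
  have hS : 0 ≤ ∑ i, h i := Finset.sum_nonneg fun i _ => (hpos i).le
  have hη1 : η * (1 + 2 * ∑ i, h i) = 1 := by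
    rw [hf.rate.1, one_div_mul_cancel (by positivity)]
  have hη2 : η * (1 + 2 * ∑ i, h i) ^ 2 = 1 + 2 * ∑ i, h i := by
    rw [sq, ← mul_assoc, hη1, one_mul]
  have h5 : 0 < t ^ 2 * (η * -L) := by
    have : 0 < -L := by linarith
    positivity
  linarith

/-- A one-sided minimax principle. -/
theorem exists_forall_le_of_forall_exists_le {V W : Type*} [TopologicalSpace V] [AddCommGroup V]
    [Module ℝ V] [IsTopologicalAddGroup V] [ContinuousSMul ℝ V] [TopologicalSpace W]
    [AddCommGroup W] [Module ℝ W] [IsTopologicalAddGroup W] [ContinuousSMul ℝ W] {X : Set V}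
    {Y : Set W} {φ : V → W → ℝ} {c : ℝ} (hX : X.Nonempty) (hXc : Convex ℝ X) (hXk : IsCompact X)
    (hYc : Convex ℝ Y) (hφX : ∀ y ∈ Y, Continuous fun x => φ x y)
    (hφX' : ∀ y ∈ Y, ConvexOn ℝ X fun x => φ x y) (hφY : ∀ x ∈ X, Continuous fun y => φ x y)
    (hφY' : ∀ x ∈ X, ConcaveOn ℝ Y fun y => φ x y) (hle : ∀ y ∈ Y, ∃ x ∈ X, φ x y ≤ c) :
    ∃ x ∈ X, ∀ y ∈ Y, φ x y ≤ c := by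
  -- Compactness leaves finitely many `y` to beat all of `X`; the finite form of Sion's theorem
  -- merges them into one.
  by_contra! hlt
  obtain ⟨s, hs⟩ := hXk.elim_finite_subcover (fun y : Y => {x | c < φ x y})
    (fun y => isOpen_lt continuous_const (hφX y y.2)) fun x hx => by
      obtain ⟨y, hy, hxy⟩ := hlt x hx
      exact Set.mem_iUnion.2 ⟨⟨y, hy⟩, hxy⟩
  obtain ⟨y, hy, hxy⟩ := Sion.exists_lt_iInf_of_lt_iInf_of_finite hX hXk
    (fun y hy => (hφX y hy).continuousOn.lowerSemicontinuousOn)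
    (fun y hy => (hφX' y hy).quasiconvexOn) hYc
    (fun x hx => (hφY x hx).continuousOn.upperSemicontinuousOn)
    (fun x hx => (hφY' x hx).quasiconcaveOn) hXc
    (s := Subtype.val '' (s : Set Y)) (s.finite_toSet.image _) (Subtype.coe_image_subset _ _)
    (t := c) fun x hx => by
      obtain ⟨y, hy, hxy⟩ := Set.mem_iUnion₂.1 (hs hx)
      exact ⟨y, ⟨y, hy, rfl⟩, hxy⟩
  obtain ⟨x, hx, hle⟩ := hle y hy
  exact (hxy x hx).not_ge hle

end F

/-! ### f-composability: uniform certificate -/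

section F

variable {n : ℕ} {h : Fin n → ℝ} {η : ℝ}

/-- The pairs of certificate coefficients and Gram matrices of gradients that occur for some
interpolation data. -/
def gramData (h : Fin n → ℝ) : Set ((Fin (n + 1) → ℝ) × (Fin (n + 1) → Fin (n + 1) → ℝ)) :=
  {y | ∃ (E : Type) (_ : NormedAddCommGroup E) (_ : InnerProductSpace ℝ E)
    (_ : FiniteDimensional ℝ E) (x g : Fin (n + 1) → E) (F : Fin (n + 1) → ℝ),
    IsGDData h x g F ∧ y = (certCoeff x g F, fun i j => inner ℝ (g i) (g j))}

/-- Coefficients and Gram matrices are quadratic in the data and add over orthogonal sums, so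
scaling by `√s` and `√t` gives the weights `s` and `t`. -/
theorem convex_gramData (h : Fin n → ℝ) : Convex ℝ (gramData h) := by
  rintro _ ⟨E, _, _, _, x, g, F, hD, rfl⟩ _ ⟨E', _, _, _, x', g', F', hD', rfl⟩ s t hs ht -
  refine ⟨WithLp 2 (E × E'), inferInstance, inferInstance, inferInstance, _, _, _,
    (hD.smul √s).prod (hD'.smul √t), ?_⟩
  ext i j
  · simp only [certCoeff, Prod.fst_add, Prod.smul_fst, Pi.add_apply, Pi.smul_apply, smul_eq_mul,
      WithLp.prod_inner_apply, ← WithLp.toLp_sub, Prod.mk_sub_mk, WithLp.prod_norm_sq_eq_of_L2,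
      ← smul_sub, norm_smul, mul_pow, inner_smul_left, inner_smul_right, conj_trivial,
      Real.norm_eq_abs, sq_abs, Real.sq_sqrt hs, Real.sq_sqrt ht, WithLp.toLp_fst, WithLp.toLp_snd]
    linear_combination -(2 * inner ℝ (g i) (x 0 - x i)) * Real.mul_self_sqrt hs
      - (2 * inner ℝ (g' i) (x' 0 - x' i)) * Real.mul_self_sqrt ht
  · simp only [Prod.snd_add, Prod.smul_snd, Pi.add_apply, Pi.smul_apply, smul_eq_mul,
      WithLp.prod_inner_apply, inner_smul_left, inner_smul_right, conj_trivial]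
    linear_combination -inner ℝ (g i) (g j) * Real.mul_self_sqrt hs
      - inner ℝ (g' i) (g' j) * Real.mul_self_sqrt ht

theorem norm_sum_smul_sq {ι E : Type*} [Fintype ι] [NormedAddCommGroup E] [InnerProductSpace ℝ E]
    (v : ι → ℝ) (g : ι → E) :
    ‖∑ i, v i • g i‖ ^ 2 = ∑ i, ∑ j, v i * v j * inner ℝ (g i) (g j) := by
  rw [← real_inner_self_eq_norm_sq, sum_inner]
  refine Finset.sum_congr rfl fun i _ => ?_
  rw [inner_sum]
  refine Finset.sum_congr rfl fun j _ => ?_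
  rw [real_inner_smul_left, real_inner_smul_right, mul_assoc]

theorem convexOn_norm_sum_smul_sq {ι E : Type*} [Fintype ι] [NormedAddCommGroup E]
    [InnerProductSpace ℝ E] (g : ι → E) :
    ConvexOn ℝ Set.univ fun v : ι → ℝ => ‖∑ i, v i • g i‖ ^ 2 :=
  (convexOn_univ_norm.comp_linearMap (Fintype.linearCombination ℝ g)).pow
    (fun _ _ => norm_nonneg _) 2

theorem IsFComposable.exists_certificate (hpos : ∀ i, 0 < h i) (hη : 0 < η)
    (hf : IsFComposable h η) :
    ∃ v : Fin (n + 1) → ℝ, (∀ i, 0 ≤ v i) ∧ ∑ i, v i = 1 / η ∧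
      ∀ (d : ℕ) (f : EuclideanSpace ℝ (Fin d) → ℝ), IsOneSmoothConvex f →
        ∀ x₀ : EuclideanSpace ℝ (Fin d),
          0 ≤ ∑ i : Fin (n + 1), v i *
              (2 * (f (gdIter h f x₀ i) - f (gdIter h f x₀ (Fin.last n)))
                + ‖∇ f (gdIter h f x₀ i)‖ ^ 2
                + 2 * inner ℝ (∇ f (gdIter h f x₀ i)) (x₀ - gdIter h f x₀ i))
            - ‖∑ i : Fin (n + 1), v i • ∇ f (gdIter h f x₀ i)‖ ^ 2 := by
  rcases Nat.eq_zero_or_pos n with rfl | hn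
  · have hη1 : η = 1 := by simpa [FGRateIdentity] using hf.rate.1
    refine ⟨fun _ => 1, fun _ => zero_le_one, by simp [hη1], fun d f _ x₀ => ?_⟩
    have : gdIter h f x₀ 0 = x₀ := rfl
    simp [this]
  -- The negated certificate: linear in the data `y`, and convex in `v` because `y.2` is a Gram
  -- matrix.
  let φ : (Fin (n + 1) → ℝ) → ((Fin (n + 1) → ℝ) × (Fin (n + 1) → Fin (n + 1) → ℝ)) → ℝ :=
    fun v y => ∑ i, ∑ j, v i * v j * y.2 i j - ∑ i, v i * y.1 i
  obtain ⟨v, ⟨w, hw, rfl⟩, hv⟩ := exists_forall_le_of_forall_exists_le (φ := φ) (c := 0)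
    (Set.Nonempty.image _ ⟨_, single_mem_stdSimplex ℝ (0 : Fin (n + 1))⟩)
    (convex_smul_stdSimplex (1 / η) (Fin (n + 1))) (isCompact_smul_stdSimplex _ _)
    (convex_gramData h) (fun y _ => by fun_prop)
    (by
      rintro _ ⟨E, _, _, _, x, g, F, hD, rfl⟩
      simp only [φ, ← norm_sum_smul_sq]
      refine ((convexOn_norm_sum_smul_sq g).subset (Set.subset_univ _)
        (convex_smul_stdSimplex _ _)).sub ⟨convex_smul_stdSimplex _ _, ?_⟩
      intro v _ w _ s t _ _ _
      simp only [smul_eq_mul, Pi.add_apply, Pi.smul_apply, Finset.mul_sum,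
        ← Finset.sum_add_distrib]
      exact (Finset.sum_congr rfl fun i _ => by ring).le)
    (fun v _ => by fun_prop)
    (by
      intro v _
      refine ⟨convex_gramData h, ?_⟩
      intro y _ z _ s t _ _ _
      simp only [φ, smul_eq_mul, Prod.fst_add, Prod.snd_add, Prod.smul_fst, Prod.smul_snd,
        Pi.add_apply, Pi.smul_apply, mul_sub, Finset.mul_sum, mul_add, Finset.sum_add_distrib]
      simp only [mul_left_comm s, mul_left_comm t]
      linarith)
    (by
      rintro _ ⟨E, _, _, _, x, g, F, hD, rfl⟩
      obtain ⟨v, hvX, hv⟩ := hf.exists_nonneg_of_isGDData hpos hη hn hD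
      exact ⟨v, hvX, by simpa only [φ, ← norm_sum_smul_sq, sub_nonpos, sub_nonneg] using hv⟩)
  refine ⟨(1 / η) • w, fun i => mul_nonneg (by positivity) (hw.1 i), ?_, fun d f hf x₀ => ?_⟩
  · simp only [Pi.smul_apply, smul_eq_mul, ← Finset.mul_sum, hw.2, mul_one]
  · have h1 := hv _ ⟨_, inferInstance, inferInstance, inferInstance, _, _, _,
      hf.isGDData h x₀, rfl⟩
    simpa only [φ, ← norm_sum_smul_sq, sub_nonpos, sub_nonneg, certCoeff, gdIter_zero] using h1

/-- Co-coercivity at a minimizer, in the shape used to evaluate certificates. -/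
theorem IsOneSmoothConvex.certTerm_le {d : ℕ} {f : EuclideanSpace ℝ (Fin d) → ℝ}
    (hf : IsOneSmoothConvex f) {xs : EuclideanSpace ℝ (Fin d)} (hxs : ∀ y, f xs ≤ f y)
    (x₀ y : EuclideanSpace ℝ (Fin d)) (c : ℝ) :
    2 * (f y - c) + ‖∇ f y‖ ^ 2 + 2 * inner ℝ (∇ f y) (x₀ - y)
      ≤ 2 * (f xs - c) + 2 * inner ℝ (∇ f y) (x₀ - xs) := by
  have h1 := hf.add_inner_add_le xs y
  rw [gradient_eq_zero_of_forall_le hxs, zero_sub, norm_neg] at h1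
  have h2 : x₀ - y = (xs - y) + (x₀ - xs) := by abel
  rw [h2, inner_add_right]
  linarith

/-- Summed form of `IsOneSmoothConvex.certTerm_le`. -/
theorem IsOneSmoothConvex.sum_certTerm_le {ι : Type*} [Fintype ι] {d : ℕ}
    {f : EuclideanSpace ℝ (Fin d) → ℝ} (hf : IsOneSmoothConvex f)
    {xs : EuclideanSpace ℝ (Fin d)} (hxs : ∀ y, f xs ≤ f y) (x₀ : EuclideanSpace ℝ (Fin d))
    (y : ι → EuclideanSpace ℝ (Fin d)) (c : ℝ) {v : ι → ℝ} (hv : ∀ i, 0 ≤ v i) :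
    ∑ i, v i * (2 * (f (y i) - c) + ‖∇ f (y i)‖ ^ 2 + 2 * inner ℝ (∇ f (y i)) (x₀ - y i))
      ≤ (∑ i, v i) * (2 * (f xs - c)) + 2 * inner ℝ (∑ i, v i • ∇ f (y i)) (x₀ - xs) := by
  rw [sum_inner, Finset.sum_mul, Finset.mul_sum, ← Finset.sum_add_distrib]
  refine Finset.sum_le_sum fun i _ => ?_
  have := mul_le_mul_of_nonneg_left (hf.certTerm_le hxs x₀ (y i) c) (hv i)
  rw [real_inner_smul_left]
  linarith

theorem isFComposable_of_certificate (hη : 0 < η) (hr : FGRateIdentity h η)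
    {v : Fin (n + 1) → ℝ} (hv : ∀ i, 0 ≤ v i) (hsum : ∑ i, v i = 1 / η)
    (H : ∀ (d : ℕ) (f : EuclideanSpace ℝ (Fin d) → ℝ), IsOneSmoothConvex f →
      ∀ x₀ : EuclideanSpace ℝ (Fin d),
        0 ≤ ∑ i : Fin (n + 1), v i *
            (2 * (f (gdIter h f x₀ i) - f (gdIter h f x₀ (Fin.last n)))
              + ‖∇ f (gdIter h f x₀ i)‖ ^ 2
              + 2 * inner ℝ (∇ f (gdIter h f x₀ i)) (x₀ - gdIter h f x₀ i))
          - ‖∑ i : Fin (n + 1), v i • ∇ f (gdIter h f x₀ i)‖ ^ 2) : IsFComposable h η := by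
  refine ⟨fun d f hf xs hxs x₀ => ?_, hr⟩
  have h1 := H d f hf x₀
  have h2 := hf.sum_certTerm_le hxs x₀ (gdIter h f x₀) (f (gdIter h f x₀ (Fin.last n))) hv
  -- Completing the square eliminates the weighted gradient sum.
  have h3 := norm_sub_sq_real (∑ i, v i • ∇ f (gdIter h f x₀ i)) (x₀ - xs)
  have h4 := sq_nonneg ‖∑ i, v i • ∇ f (gdIter h f x₀ i) - (x₀ - xs)‖
  rw [hsum] at h2
  have h5 : 0 ≤ η * (1 / η * (2 * (f xs - f (gdIter h f x₀ (Fin.last n)))) + ‖x₀ - xs‖ ^ 2) :=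
    mul_nonneg hη.le (by linarith)
  rw [mul_add, ← mul_assoc, mul_one_div_cancel hη.ne'] at h5
  linarith

end F

/-! ### s-composability -/

section S

variable {n : ℕ} {h : Fin n → ℝ} {η : ℝ}

theorem IsGDData.sum_smul_eq {E : Type*} [NormedAddCommGroup E] [InnerProductSpace ℝ E]
    {x g : Fin (n + 1) → E} {F : Fin (n + 1) → ℝ} (hD : IsGDData h x g F) :
    ∑ i : Fin n, h i • g i.castSucc = x 0 - x (Fin.last n) := by
  have h1 (i : Fin n) : h i • g i.castSucc = x i.castSucc - x i.succ := by rw [hD.step]; abel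
  simp only [h1, Finset.sum_sub_distrib]
  have h2 := Fin.sum_univ_succ x
  rw [Fin.sum_univ_castSucc] at h2
  rw [sub_eq_sub_iff_add_eq_add, h2, add_comm]

theorem SRateIdentity.sum_eq (hr : SRateIdentity h η) : ∑ i, h i = 1 / η - 1 := by
  rw [hr.1, one_div_one_div]
  ring

theorem norm_sub_sq_telescope {E : Type*} [NormedAddCommGroup E] [InnerProductSpace ℝ E]
    (x y z : E) : ‖y - z‖ ^ 2 = ‖x - z‖ ^ 2 - 2 * inner ℝ (x - y) (x - z) + ‖y - x‖ ^ 2 := by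
  have : y - z = (x - z) - (x - y) := by abel
  rw [this, norm_sub_sq_real, norm_sub_rev x y, real_inner_comm]

theorem isSComposable_of_nonneg (hpos : ∀ i, 0 < h i) (hη : 0 < η) (hr : SRateIdentity h η)
    (H : ∀ (d : ℕ) (f : EuclideanSpace ℝ (Fin d) → ℝ), IsOneSmoothConvex f →
      ∀ x₀ : EuclideanSpace ℝ (Fin d),
        0 ≤ ∑ i : Fin n, h i *
            (2 * (f (gdIter h f x₀ i.castSucc) - f (gdIter h f x₀ (Fin.last n)))
              + ‖∇ f (gdIter h f x₀ i.castSucc)‖ ^ 2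
              + 2 * inner ℝ (∇ f (gdIter h f x₀ i.castSucc)) (x₀ - gdIter h f x₀ i.castSucc))
          - ‖gdIter h f x₀ (Fin.last n) - x₀‖ ^ 2
          - (1 - η) / η ^ 2 * ‖∇ f (gdIter h f x₀ (Fin.last n))‖ ^ 2) : IsSComposable h η := by
  refine ⟨fun d f hf xs hxs x₀ => ?_, hr⟩
  have h1 := H d f hf x₀
  have h2 := hf.sum_certTerm_le hxs x₀ (fun i : Fin n => gdIter h f x₀ i.castSucc)
    (f (gdIter h f x₀ (Fin.last n))) fun i => (hpos i).le
  rw [(hf.isGDData h x₀).sum_smul_eq, gdIter_zero, hr.sum_eq] at h2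
  set X := gdIter h f x₀ (Fin.last n)
  have h3 := norm_sub_sq_telescope x₀ X xs
  have h4 : 0 ≤ η ^ 2 / 2 * ((1 / η - 1) * (2 * (f xs - f X)) + (‖x₀ - xs‖ ^ 2 - ‖X - xs‖ ^ 2)
      - (1 - η) / η ^ 2 * ‖∇ f X‖ ^ 2) := mul_nonneg (by positivity) (by linarith)
  have h5 : η ^ 2 / 2 * ((1 / η - 1) * (2 * (f xs - f X)) + (‖x₀ - xs‖ ^ 2 - ‖X - xs‖ ^ 2)
      - (1 - η) / η ^ 2 * ‖∇ f X‖ ^ 2) = (η - η ^ 2) * (f xs - f X)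
      + η ^ 2 / 2 * (‖x₀ - xs‖ ^ 2 - ‖X - xs‖ ^ 2) - (1 - η) / 2 * ‖∇ f X‖ ^ 2 := by
    field_simp
  linarith

/-- Gradient descent on a diagonal quadratic function whose gradients are linearly independent. -/
theorem exists_isGDData_inner_surjective (hpos : ∀ i, 0 < h i) :
    ∃ (x g : Fin (n + 1) → EuclideanSpace ℝ (Fin (n + 1))) (F : Fin (n + 1) → ℝ),
      IsGDData h x g F ∧ ∀ b : Fin (n + 1) → ℝ, ∃ w, ∀ i, inner ℝ (g i) w = b i := by
  let l : Fin (n + 1) → ℝ := fun k => 1 / ((k : ℝ) + 1)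
  have hl0 (k) : 0 < l k := by positivity
  have hl1 (k) : l k ≤ 1 := div_le_one_of_le₀ (by linarith [(k : ℕ).cast_nonneg (α := ℝ)])
    (by positivity)
  have hlinj : Function.Injective l := fun a b hab => by
    simpa [l, Fin.ext_iff] using hab
  -- Started at the all-ones vector, coordinate `k` of iterate `i` is a polynomial of degree `i` in
  -- the eigenvalue `l k`.
  let p : Fin (n + 1) → Fin (n + 1) → ℝ := fun i k =>
    ∏ j with Fin.castSucc j < i, (1 - h j * l k)
  have hp (i : Fin n) (k) : p i.succ k = p i.castSucc k * (1 - h i * l k) := by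
    simp only [p]
    rw [filter_castSucc_lt_succ, Finset.prod_insert (by simp), mul_comm]
  refine ⟨fun i => WithLp.toLp 2 (p i), fun i => WithLp.toLp 2 fun k => l k * p i k,
    fun i => ∑ k, l k * p i k ^ 2 / 2, ⟨fun i => ?_, fun i j => ?_⟩, fun b => ?_⟩
  · ext k
    simp only [PiLp.sub_apply, PiLp.smul_apply, smul_eq_mul, hp]
    ring
  · simp only [EuclideanSpace.norm_sq_eq, PiLp.inner_apply, PiLp.sub_apply, Finset.sum_div,
      ← Finset.sum_add_distrib]
    refine Finset.sum_le_sum fun k _ => ?_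
    simp only [RCLike.inner_apply, conj_trivial, Real.norm_eq_abs, sq_abs]
    have := mul_nonneg (mul_nonneg (hl0 k).le (sub_nonneg.2 (hl1 k))) (sq_nonneg (p i k - p j k))
    linarith
  -- Made monic, these polynomials of degrees `0, …, n` have the Vandermonde determinant of the
  -- distinct `l k`.
  · let q : Fin (n + 1) → Polynomial ℝ := fun i =>
      ∏ j with Fin.castSucc j < i, (Polynomial.X - Polynomial.C (1 / h j))
    let c : Fin (n + 1) → ℝ := fun i => ∏ j with Fin.castSucc j < i, (-h j)
    have hc (i) : c i ≠ 0 := Finset.prod_ne_zero_iff.2 fun j _ => neg_ne_zero.2 (hpos j).ne'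
    have hpq (i k) : p i k = c i * (q i).eval (l k) := by
      simp only [p, c, q, Polynomial.eval_prod, ← Finset.prod_mul_distrib]
      refine Finset.prod_congr rfl fun j _ => ?_
      have := (hpos j).ne'
      simp only [Polynomial.eval_sub, Polynomial.eval_X, Polynomial.eval_C]
      field_simp
      ring
    have hdet := Matrix.det_eval_matrixOfPolynomials_eq_det_vandermonde l q
      (fun i => by
        rw [Polynomial.natDegree_finsetProd_X_sub_C_eq_card]
        have : (Finset.univ.filter fun j : Fin n => j.castSucc < i).map Fin.castSuccEmb
            = Finset.Iio i := by
          ext j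
          induction j using Fin.lastCases with
          | last => simp [Fin.castSucc_ne_last, Fin.le_last]
          | cast j => simp
        rw [← Finset.card_map, this, Fin.card_Iio])
      (fun i => Polynomial.monic_prod_X_sub_C _ _)
    set M : Matrix (Fin (n + 1)) (Fin (n + 1)) ℝ := Matrix.of fun k i => (q i).eval (l k) with hM
    have hunit : IsUnit M.transpose := by
      rw [Matrix.isUnit_iff_isUnit_det, Matrix.det_transpose, ← hdet, isUnit_iff_ne_zero]
      exact Matrix.det_vandermonde_ne_zero_iff.2 hlinj
    obtain ⟨w, hw⟩ := Matrix.mulVec_surjective_iff_isUnit.2 hunit fun i => b i / c i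
    refine ⟨WithLp.toLp 2 fun k => w k / l k, fun i => ?_⟩
    have h1 := congrFun hw i
    rw [eq_div_iff (hc i)] at h1
    rw [← h1, Matrix.mulVec, dotProduct, Finset.sum_mul, PiLp.inner_apply]
    refine Finset.sum_congr rfl fun k _ => ?_
    have := (hl0 k).ne'
    simp only [RCLike.inner_apply, conj_trivial, hpq, M, Matrix.transpose_apply, Matrix.of_apply]
    field_simp

/-- The left-hand side of the characterization of s-composability. -/
noncomputable def sExcess (h : Fin n → ℝ) (η : ℝ) {E : Type*} [NormedAddCommGroup E] [InnerProductSpace ℝ E]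
    (x g : Fin (n + 1) → E) (F : Fin (n + 1) → ℝ) : ℝ :=
  ∑ i : Fin n, h i * certCoeff x g F i.castSucc - ‖x (Fin.last n) - x 0‖ ^ 2
    - (1 - η) / η ^ 2 * ‖g (Fin.last n)‖ ^ 2

section sExcess

variable {E E' : Type*} [NormedAddCommGroup E] [InnerProductSpace ℝ E] [NormedAddCommGroup E']
  [InnerProductSpace ℝ E'] (x g : Fin (n + 1) → E) (F : Fin (n + 1) → ℝ)

theorem certCoeff_smul (t : ℝ) (i : Fin (n + 1)) :
    certCoeff (fun i => t • x i) (fun i => t • g i) (fun i => t ^ 2 * F i) i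
      = t ^ 2 * certCoeff x g F i := by
  simp only [certCoeff, ← smul_sub, norm_smul, mul_pow, real_inner_smul_left,
    real_inner_smul_right, Real.norm_eq_abs, sq_abs]
  ring

theorem certCoeff_prod (x' g' : Fin (n + 1) → E') (F' : Fin (n + 1) → ℝ) (i : Fin (n + 1)) :
    certCoeff (fun i => WithLp.toLp 2 (x i, x' i)) (fun i => WithLp.toLp 2 (g i, g' i))
      (fun i => F i + F' i) i = certCoeff x g F i + certCoeff x' g' F' i := by
  simp only [certCoeff, WithLp.prod_inner_apply, ← WithLp.toLp_sub, Prod.mk_sub_mk,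
    WithLp.prod_norm_sq_eq_of_L2, WithLp.toLp_fst, WithLp.toLp_snd]
  ring

theorem sExcess_smul (t : ℝ) :
    sExcess h η (fun i => t • x i) (fun i => t • g i) (fun i => t ^ 2 * F i)
      = t ^ 2 * sExcess h η x g F := by
  simp only [sExcess, certCoeff_smul, ← smul_sub, norm_smul, mul_pow, Real.norm_eq_abs, sq_abs,
    mul_sub, Finset.mul_sum, mul_left_comm (t ^ 2)]

theorem sExcess_prod (x' g' : Fin (n + 1) → E') (F' : Fin (n + 1) → ℝ) :
    sExcess h η (fun i => WithLp.toLp 2 (x i, x' i)) (fun i => WithLp.toLp 2 (g i, g' i))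
      (fun i => F i + F' i) = sExcess h η x g F + sExcess h η x' g' F' := by
  simp only [sExcess, certCoeff_prod, mul_add, Finset.sum_add_distrib, ← WithLp.toLp_sub,
    Prod.mk_sub_mk, WithLp.prod_norm_sq_eq_of_L2, WithLp.toLp_fst, WithLp.toLp_snd]
  ring

end sExcess

/-- Surjectivity allows an `xs` at which every raised tangent equals `m`. The estimates of the
converse direction become equalities, so the s-bound is the claim up to the factor `η ^ 2 / 2`. -/
theorem IsSComposable.sExcess_nonneg_of_inner_surjective {E : Type*} [NormedAddCommGroup E]
    [InnerProductSpace ℝ E] [FiniteDimensional ℝ E] {x g : Fin (n + 1) → E}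
    {F : Fin (n + 1) → ℝ} (hη : 0 < η) (hs : IsSComposable h η)
    (hD : IsGDData h x g F) (hsurj : ∀ b : Fin (n + 1) → ℝ, ∃ w, ∀ i, inner ℝ (g i) w = b i) :
    0 ≤ sExcess h η x g F := by
  obtain ⟨m, hm⟩ := (Set.finite_range fun i => F i - ‖g i‖ ^ 2 / 2).bddBelow
  obtain ⟨xs, hxs⟩ := hsurj fun i => m - F i - ‖g i‖ ^ 2 / 2 + inner ℝ (g i) (x i)
  obtain ⟨d, f, x₀, ys, hf, hmin, hys, hval⟩ := hD.exists_function (xs := xs) (m := m)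
    (fun i => by rw [inner_sub_right, hxs]; linarith) (fun i => hm ⟨i, rfl⟩)
  have hb := hs.bound d f hf ys hmin x₀
  have h0 := (hval 0).2.2
  rw [gdIter_zero] at h0
  rw [(hval (Fin.last n)).1, (hval (Fin.last n)).2.1, (hval (Fin.last n)).2.2, h0, hys] at hb
  have h1 : ∑ i : Fin n, h i * certCoeff x g F i.castSucc
      = (1 / η - 1) * (2 * (m - F (Fin.last n)))
        + 2 * inner ℝ (x 0 - x (Fin.last n)) (x 0 - xs) := by
    rw [← hs.rate.sum_eq, ← hD.sum_smul_eq, sum_inner, Finset.sum_mul, Finset.mul_sum,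
      ← Finset.sum_add_distrib]
    refine Finset.sum_congr rfl fun i _ => ?_
    rw [real_inner_smul_left, certCoeff, inner_sub_right, inner_sub_right, hxs]
    ring
  have h2 := norm_sub_sq_telescope (x 0) (x (Fin.last n)) xs
  refine nonneg_of_mul_nonneg_right (a := η ^ 2 / 2) ?_ (by positivity)
  have h3 : η ^ 2 / 2 * sExcess h η x g F = (η - η ^ 2) * (m - F (Fin.last n))
      + η ^ 2 / 2 * (‖x 0 - xs‖ ^ 2 - ‖x (Fin.last n) - xs‖ ^ 2)
      - (1 - η) / 2 * ‖g (Fin.last n)‖ ^ 2 := by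
    rw [sExcess, h1, h2]
    field_simp
    ring
  linarith

/-- An orthogonal generic run scaled by `t > 0` makes the gradients independent and changes the
excess only by a multiple of `t ^ 2`, which disappears as `t → 0`. -/
theorem IsSComposable.nonneg (hpos : ∀ i, 0 < h i) (hη : 0 < η) (hs : IsSComposable h η) {d : ℕ}
    {f : EuclideanSpace ℝ (Fin d) → ℝ} (hf : IsOneSmoothConvex f)
    (x₀ : EuclideanSpace ℝ (Fin d)) :
    0 ≤ ∑ i : Fin n, h i *
        (2 * (f (gdIter h f x₀ i.castSucc) - f (gdIter h f x₀ (Fin.last n)))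
          + ‖∇ f (gdIter h f x₀ i.castSucc)‖ ^ 2
          + 2 * inner ℝ (∇ f (gdIter h f x₀ i.castSucc)) (x₀ - gdIter h f x₀ i.castSucc))
      - ‖gdIter h f x₀ (Fin.last n) - x₀‖ ^ 2
      - (1 - η) / η ^ 2 * ‖∇ f (gdIter h f x₀ (Fin.last n))‖ ^ 2 := by
  have hD := hf.isGDData h x₀
  obtain ⟨x, g, F, hQ, hsurj⟩ := exists_isGDData_inner_surjective hpos
  change 0 ≤ sExcess h η (gdIter h f x₀) (fun i => ∇ f (gdIter h f x₀ i))
    (fun i => f (gdIter h f x₀ i))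
  refine neg_nonpos.1 (nonpos_of_forall_le_mul (abs_nonneg (sExcess h η x g F))
    fun t ht0 ht1 => ?_)
  have h1 := hs.sExcess_nonneg_of_inner_surjective hη (hD.prod (hQ.smul t)) fun b => by
    obtain ⟨w, hw⟩ := hsurj fun i => b i / t
    refine ⟨WithLp.toLp 2 (0, w), fun i => ?_⟩
    simp only [WithLp.prod_inner_apply, inner_zero_right, zero_add, real_inner_smul_left, hw]
    field_simp
  rw [sExcess_prod, sExcess_smul] at h1
  have h2 : t ^ 2 * sExcess h η x g F ≤ t * |sExcess h η x g F| :=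
    (mul_le_mul_of_nonneg_left (le_abs_self _) (sq_nonneg t)).trans
      (mul_le_mul_of_nonneg_right (by nlinarith) (abs_nonneg _))
  linarith

end S

theorem mainTheorem4 (n : ℕ) (h : Fin n → ℝ) (hpos : ∀ i, 0 < h i) (η : ℝ) (hη : 0 < η) :
    (FGRateIdentity h η →
      (IsFComposable h η ↔
        ∃ v : Fin (n + 1) → ℝ, (∀ i, 0 ≤ v i) ∧ ∑ i, v i = 1 / η ∧
          ∀ (d : ℕ) (f : EuclideanSpace ℝ (Fin d) → ℝ), IsOneSmoothConvex f →
            ∀ x₀ : EuclideanSpace ℝ (Fin d),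
              ∑ i : Fin (n + 1), v i *
                  (2 * (f (gdIter h f x₀ i) - f (gdIter h f x₀ (Fin.last n)))
                    + ‖∇ f (gdIter h f x₀ i)‖ ^ 2
                    + 2 * inner ℝ (∇ f (gdIter h f x₀ i)) (x₀ - gdIter h f x₀ i))
                - ‖∑ i : Fin (n + 1), v i • ∇ f (gdIter h f x₀ i)‖ ^ 2 ≥ 0)) ∧
    (FGRateIdentity h η →
      (IsGComposable h η ↔
        ∀ (d : ℕ) (f : EuclideanSpace ℝ (Fin d) → ℝ), IsOneSmoothConvex f →
          ∀ x₀ : EuclideanSpace ℝ (Fin d),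
            η * (f x₀ - f (gdIter h f x₀ (Fin.last n)))
              - (1 - η) / 2 * ‖∇ f (gdIter h f x₀ (Fin.last n))‖ ^ 2 ≥ 0)) ∧
    (SRateIdentity h η →
      (IsSComposable h η ↔
        ∀ (d : ℕ) (f : EuclideanSpace ℝ (Fin d) → ℝ), IsOneSmoothConvex f →
          ∀ x₀ : EuclideanSpace ℝ (Fin d),
            ∑ i : Fin n, h i *
                (2 * (f (gdIter h f x₀ i.castSucc) - f (gdIter h f x₀ (Fin.last n)))
                  + ‖∇ f (gdIter h f x₀ i.castSucc)‖ ^ 2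
                  + 2 * inner ℝ (∇ f (gdIter h f x₀ i.castSucc)) (x₀ - gdIter h f x₀ i.castSucc))
              - ‖gdIter h f x₀ (Fin.last n) - x₀‖ ^ 2
              - (1 - η) / η ^ 2 * ‖∇ f (gdIter h f x₀ (Fin.last n))‖ ^ 2 ≥ 0)) := by
  refine ⟨fun hr => ⟨fun hf => hf.exists_certificate hpos hη, ?_⟩,
    fun hr => ⟨fun hg d f hf x₀ => hg.nonneg hpos hf x₀, isGComposable_of_nonneg hη.le hr⟩,
    fun hr => ⟨fun hs d f hf x₀ => hs.nonneg hpos hη hf x₀, isSComposable_of_nonneg hpos hη hr⟩⟩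
  rintro ⟨v, hv, hsum, H⟩
  exact isFComposable_of_certificate hη hr hv hsum H
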